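/- Let $W\ge 1$ and $T\ge 0$ be integers, let $f_1,\dots,f_T:\{0,1\}^3\to\{0,1\}$ be arbitrary Boolean rules, and let $\varepsilon\ge 0$. For $x\in\{0,1\}^W$ define, with position indices modulo $W$, $$u_i^{(0)}:=x_i,\qquad u_i^{(t)}:=f_t\bigl(u_{i-1}^{(t-1)},u_i^{(t-1)},u_{i+1}^{(t-1)}\bigr)\quad(1\le t\le T).$$ A $T$-block post-LN transformer encoder (in evaluation mode, i.e. without dropout) of model dimension $d$, with $H$ heads of dimension $d_h=d/H$ and FFN width $F$, maps $x$ to logits $\ell_i(x)$ as follows. The input tokens are $h_i^{(0)}=x_i a+b+\pi(i)$, with $a,b\in\mathbb R^d$ and learned absolute position embeddings $\pi(i)\in\mathbb R^d$. Each block $t$ has its own parameters and computes $$z_i=\mathrm{LN}_1\bigl(h_i^{(t-1)}+\mathrm{Attn}(h^{(t-1)})_i\bigr),\qquad h_i^{(t)}=\mathrm{LN}_2\bigl(z_i+\mathrm{FFN}(z_i)\bigr).$$ Here $\mathrm{Attn}$ is $H$-head self-attention: in each head the weights are the softmax over $j$ of the scores $\langle Q h_i+b_Q,\,K h_j+b_K\rangle/\sqrt{d_h}$,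 the head output at $i$ is the corresponding weighted sum of the values $V h_j+b_V\in\mathbb R^{d_h}$, and the concatenated head outputs are mapped affinely to $\mathbb R^d$. Further, $\mathrm{FFN}(z)=W_2\,\mathrm{ReLU}(W_1z+b_1)+b_2$ with $F$ hidden units, and $\mathrm{LN}(z)_k=\gamma_k\,(z_k-\mu(z))/\sqrt{\sigma^2(z)+\varepsilon}+\beta_k$, where $\mu(z)$ and $\sigma^2(z)$ are the mean and (population) variance of the coordinates of $z$, and the gain $\gamma$ and bias $\beta$ are parameters of each LayerNorm. The logit is $\ell_i(x)=\langle w,h_i^{(T)}\rangle+c$ with $w\in\mathbb R^d$, $c\in\mathbb R$. Then there is such an encoder with exactly $T$ blocks, model dimension $d=2W+6$, two heads per block (so $d_h=W+3$) and FFN width $14$ per block, all real parameters being independent of $x$ and $i$, such that for every $x\in\{0,1\}^W$ every LayerNorm is evaluated at a vector with $\sigma^2+\varepsilon>0$ (so the network is well defined on $x$ also when $\varepsilon=0$), and for every position $i$ $$\ell_i(x)>0\iff u_i^{(T)}=1.$$ -/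

import Mathlib

open scoped Matrix

/-! ### Composed radius-one cellular automata on a ring -/

/-- A Boolean rule on three bits (left, centre, right). -/
abbrev LocalRule : Type := Bool × Bool × Bool → Bool

/-- One synchronous update of a periodic row of width `W`.
Addition and subtraction in `Fin W` are modulo `W`. -/
def caStep {W : ℕ} [NeZero W] (f : LocalRule) (u : Fin W → Bool) : Fin W → Bool :=
  fun i => f (u (i - 1), u i, u (i + 1))

/-- The row `u^(t)` for `t = 0, …, T`: it starts at `x`, and the `t`-th update uses the `t`-th rule. -/
def caState {W T : ℕ} [NeZero W] (f : Fin T → LocalRule) (x : Fin W → Bool) :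
    Fin (T + 1) → Fin W → Bool :=
  Fin.induction (motive := fun _ => Fin W → Bool) x (fun t u => caStep (f t) u)

noncomputable section

/-! ### LayerNorm -/

/-- Mean of the coordinates of a vector. -/
def vecMean {d : ℕ} (z : Fin d → ℝ) : ℝ := (∑ k, z k) / d

/-- (Population) variance of the coordinates of a vector. -/
def vecVar {d : ℕ} (z : Fin d → ℝ) : ℝ := (∑ k, (z k - vecMean z) ^ 2) / d

/-- Trainable parameters of a LayerNorm: gain and bias. -/
structure LayerNormParams (d : ℕ) where
  gain : Fin d → ℝ
  bias : Fin d → ℝ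

/-- LayerNorm with stabilizer `ε`. -/
def LayerNormParams.apply {d : ℕ} (p : LayerNormParams d) (ε : ℝ) (z : Fin d → ℝ) : Fin d → ℝ :=
  fun k => p.gain k * ((z k - vecMean z) / Real.sqrt (vecVar z + ε)) + p.bias k

/-! ### Multi-head softmax self-attention -/

/-- Affine query, key and value projections of one attention head of dimension `dh`. -/
structure HeadParams (d dh : ℕ) where
  Wq : Matrix (Fin dh) (Fin d) ℝ
  bq : Fin dh → ℝ
  Wk : Matrix (Fin dh) (Fin d) ℝ
  bk : Fin dh → ℝ
  Wv : Matrix (Fin dh) (Fin d) ℝ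
  bv : Fin dh → ℝ

/-- Scaled dot-product score of query position `i` against key position `j`. -/
def HeadParams.score {d dh W : ℕ} (p : HeadParams d dh) (h : Fin W → Fin d → ℝ)
    (i j : Fin W) : ℝ :=
  ((p.Wq *ᵥ h i + p.bq) ⬝ᵥ (p.Wk *ᵥ h j + p.bk)) / Real.sqrt dh

/-- Softmax attention weight that position `i` puts on position `j`. -/
def HeadParams.weight {d dh W : ℕ} (p : HeadParams d dh) (h : Fin W → Fin d → ℝ)
    (i j : Fin W) : ℝ :=
  Real.exp (p.score h i j) / ∑ k, Real.exp (p.score h i k)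

/-- Output of one head at position `i`. -/
def HeadParams.apply {d dh W : ℕ} (p : HeadParams d dh) (h : Fin W → Fin d → ℝ)
    (i : Fin W) : Fin dh → ℝ :=
  ∑ j, p.weight h i j • (p.Wv *ᵥ h j + p.bv)

/-- `H` heads together with the affine output projection of their concatenation. -/
structure AttentionParams (d H dh : ℕ) where
  head : Fin H → HeadParams d dh
  Wo : Matrix (Fin d) (Fin H × Fin dh) ℝ
  bo : Fin d → ℝ

/-- Multi-head self-attention; the concatenated head outputs are indexed by `Fin H × Fin dh`. -/
def AttentionParams.apply {d H dh W : ℕ} (p : AttentionParams d H dh) (h : Fin W → Fin d → ℝ)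
    (i : Fin W) : Fin d → ℝ :=
  p.Wo *ᵥ (fun a : Fin H × Fin dh => (p.head a.1).apply h i a.2) + p.bo

/-! ### ReLU feed-forward network -/

/-- One-hidden-layer feed-forward network with `F` hidden units. -/
structure FFNParams (d F : ℕ) where
  W₁ : Matrix (Fin F) (Fin d) ℝ
  b₁ : Fin F → ℝ
  W₂ : Matrix (Fin d) (Fin F) ℝ
  b₂ : Fin d → ℝ

/-- The feed-forward network with ReLU activation `max · 0`. -/
def FFNParams.apply {d F : ℕ} (p : FFNParams d F) (z : Fin d → ℝ) : Fin d → ℝ :=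
  p.W₂ *ᵥ (fun k => max ((p.W₁ *ᵥ z + p.b₁) k) 0) + p.b₂

/-! ### Post-LN encoder blocks and encoders (evaluation mode: no dropout) -/

/-- Parameters of a post-LN encoder block with model dimension `d`, `H` heads of dimension `dh`
and feed-forward width `F`. -/
structure BlockParams (d H dh F : ℕ) where
  attn : AttentionParams d H dh
  ln₁ : LayerNormParams d
  ffn : FFNParams d F
  ln₂ : LayerNormParams d

namespace BlockParams

variable {d H dh F W : ℕ}

/-- Input plus attention output: the argument of the first LayerNorm. -/
def preNorm₁ (p : BlockParams d H dh F) (h : Fin W → Fin d → ℝ) (i : Fin W) : Fin d → ℝ :=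
  h i + p.attn.apply h i

/-- Output of the attention sublayer. -/
def mid (p : BlockParams d H dh F) (ε : ℝ) (h : Fin W → Fin d → ℝ) (i : Fin W) : Fin d → ℝ :=
  p.ln₁.apply ε (p.preNorm₁ h i)

/-- Attention-sublayer output plus feed-forward output: the argument of the second LayerNorm. -/
def preNorm₂ (p : BlockParams d H dh F) (ε : ℝ) (h : Fin W → Fin d → ℝ) (i : Fin W) :
    Fin d → ℝ :=
  p.mid ε h i + p.ffn.apply (p.mid ε h i)

/-- Output of the block. -/
def apply (p : BlockParams d H dh F) (ε : ℝ) (h : Fin W → Fin d → ℝ) (i : Fin W) : Fin d → ℝ :=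
  p.ln₂.apply ε (p.preNorm₂ ε h i)

end BlockParams

/-- Parameters of a `T`-block post-LN encoder on rows of width `W`: affine embedding of the scalar
token, learned absolute position embeddings, `T` blocks, and an affine scalar readout. -/
structure Encoder (W d H dh F T : ℕ) where
  embW : Fin d → ℝ
  embB : Fin d → ℝ
  pos : Fin W → Fin d → ℝ
  block : Fin T → BlockParams d H dh F
  outW : Fin d → ℝ
  outB : ℝ

namespace Encoder

variable {W d H dh F T : ℕ}

/-- Input layer; the bit `x j` is fed in as the real scalar `0` or `1`. -/
def input (m : Encoder W d H dh F T) (x : Fin W → Bool) (j : Fin W) : Fin d → ℝ :=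
  (if x j then (1 : ℝ) else 0) • m.embW + m.embB + m.pos j

/-- The token vectors after `t` blocks, for `t = 0, …, T`. -/
def hidden (m : Encoder W d H dh F T) (ε : ℝ) (x : Fin W → Bool) :
    Fin (T + 1) → Fin W → Fin d → ℝ :=
  Fin.induction (motive := fun _ => Fin W → Fin d → ℝ) (m.input x)
    (fun t h => (m.block t).apply ε h)

/-- The final logit at position `i`. -/
def logit (m : Encoder W d H dh F T) (ε : ℝ) (x : Fin W → Bool) (i : Fin W) : ℝ :=
  m.outW ⬝ᵥ m.hidden ε x (Fin.last T) i + m.outB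

/-- Every LayerNorm met while evaluating the encoder on `x` has a positive number under its square
root, so no division by zero occurs. This is automatic if `0 < ε`, and a condition if `ε = 0`. -/
def NormsDefined (m : Encoder W d H dh F T) (ε : ℝ) (x : Fin W → Bool) : Prop :=
  ∀ (t : Fin T) (i : Fin W),
    0 < vecVar ((m.block t).preNorm₁ (m.hidden ε x t.castSucc) i) + ε ∧
    0 < vecVar ((m.block t).preNorm₂ ε (m.hidden ε x t.castSucc) i) + ε

end Encoder

end

/-! Each feature is stored with both signs, so a token has mean zero and its variance depends only
on the squares of its features. Bits are coded as ±1, so with exact neighbour bits each LayerNorm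
sees a known variance and a constant gain makes it act as the identity. The one-hot position keeps
that variance positive even for `ε = 0`.

If attention were hard, every block would be exact: two heads fetch the neighbour bits by matching
one-hot positions, and eight ReLU units recognise the pattern and write the update. Softmax gives
this in the limit of infinite sharpness `β` (`ruleBlock_apply_tendsto`). No error estimates are
needed, since there are finitely many rows and, for large `β`, a block is continuous at their codes.
Working backwards from the open sign condition at the output, `exists_block` chooses `β` so that a
neighbourhood of each code is sent into the prescribed neighbourhood of the updated code, and
`exists_stack` iterates this. -/

open Filter Topology

noncomputable section

/-! ### Antisymmetric feature vectors -/

/-- Features carried by a token: a one-hot position and three signed bits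
(own bit, left neighbour, right neighbour). -/
abbrev Feature (W : ℕ) : Type := Fin W ⊕ Fin 3

/-- Every feature occupies two model coordinates, one for each sign. -/
def coordEquiv (W : ℕ) : Feature W × Bool ≃ Fin (2 * W + 6) :=
  Fintype.equivOfCardEq (by simp; ring)

/-- The coordinate that holds a feature with positive sign. -/
def coord {W : ℕ} (q : Feature W) : Fin (2 * W + 6) := coordEquiv W (q, true)

/-- The model vector that holds each feature once with each sign. -/
def lift {W : ℕ} : (Feature W → ℝ) →ₗ[ℝ] (Fin (2 * W + 6) → ℝ) where
  toFun v k := (if ((coordEquiv W).symm k).2 then 1 else -1) * v ((coordEquiv W).symm k).1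
  map_add' v w := by ext k; simp [mul_add]
  map_smul' c v := by ext k; simp [mul_left_comm]

theorem lift_coord {W : ℕ} (v : Feature W → ℝ) (q : Feature W) : lift v (coord q) = v q := by
  simp [lift, coord]

theorem vecMean_lift {W : ℕ} (v : Feature W → ℝ) : vecMean (lift v) = 0 := by
  have h : ∑ k, lift v k = 0 := by
    rw [← (coordEquiv W).sum_comp, Fintype.sum_prod_type]
    simp [lift]
  simp [vecMean, h]

theorem vecVar_lift {W : ℕ} (v : Feature W → ℝ) :
    vecVar (lift v) = 2 * (∑ q, v q ^ 2) / (2 * W + 6 : ℕ) := by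
  have h : ∑ k, lift v k ^ 2 = 2 * ∑ q, v q ^ 2 := by
    rw [← (coordEquiv W).sum_comp, Fintype.sum_prod_type, Finset.mul_sum]
    simp [lift, two_mul]
  simp only [vecVar, vecMean_lift, sub_zero, h]

/-- Token vector at position `i` with own, left and right entries `s`, `l`, `r`. -/
def token {W : ℕ} (i : Fin W) (s l r : ℝ) : Fin (2 * W + 6) → ℝ :=
  lift (Sum.elim (Pi.single i 1) ![s, l, r])

theorem vecVar_token {W : ℕ} (i : Fin W) (s l r : ℝ) :
    vecVar (token i s l r) = 2 * (1 + s ^ 2 + l ^ 2 + r ^ 2) / (2 * W + 6 : ℕ) := by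
  simp [token, vecVar_lift, Fin.sum_univ_three, Pi.single_apply, ite_pow]
  ring

theorem token_pos {W : ℕ} (i k : Fin W) (s l r : ℝ) :
    token i s l r (coord (Sum.inl k)) = if k = i then 1 else 0 := by
  simp [token, lift_coord, Pi.single_apply]

theorem token_bit {W : ℕ} (i : Fin W) (s l r : ℝ) (a : Fin 3) :
    token i s l r (coord (Sum.inr a)) = ![s, l, r] a := by
  simp [token, lift_coord]

theorem token_add {W : ℕ} (i : Fin W) (s l r s' l' r' : ℝ) :
    token i s l r + lift (Sum.elim 0 ![s', l', r']) = token i (s + s') (l + l') (r + r') := by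
  rw [token, token, ← map_add]
  congr 1
  ext (k | a)
  · simp
  · fin_cases a <;> simp

/-- A Boolean as a sign. -/
def boolSign (b : Bool) : ℝ := if b then 1 else -1

theorem boolSign_sq (b : Bool) : boolSign b ^ 2 = 1 := by cases b <;> simp [boolSign]

/-- The encoding of a row, one token per position. -/
def rowCode {W : ℕ} (u : Fin W → Bool) (i : Fin W) : Fin (2 * W + 6) → ℝ :=
  token i (boolSign (u i)) 0 0

/-! ### LayerNorm -/

/-- LayerNorm that fixes mean-zero vectors of variance `v`. -/
def identityNorm (d : ℕ) (ε v : ℝ) : LayerNormParams d := ⟨fun _ => Real.sqrt (v + ε), 0⟩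

theorem identityNorm_apply {d : ℕ} {ε v : ℝ} {z : Fin d → ℝ} (hm : vecMean z = 0)
    (hv : vecVar z = v) (hpos : 0 < v + ε) : (identityNorm d ε v).apply ε z = z := by
  have := (Real.sqrt_pos.2 hpos).ne'
  ext k
  simp only [LayerNormParams.apply, identityNorm, hm, hv, Pi.zero_apply]
  field_simp
  ring

theorem continuous_vecMean {d : ℕ} : Continuous (vecMean : (Fin d → ℝ) → ℝ) := by
  unfold vecMean; fun_prop

theorem continuous_vecVar {d : ℕ} : Continuous (vecVar : (Fin d → ℝ) → ℝ) := by
  have := continuous_vecMean (d := d)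
  unfold vecVar; fun_prop

theorem LayerNormParams.continuousAt_apply {d : ℕ} (p : LayerNormParams d) {ε : ℝ}
    {z : Fin d → ℝ} (hz : 0 < vecVar z + ε) : ContinuousAt (p.apply ε) z := by
  refine continuousAt_pi.2 fun k => ?_
  have h1 := continuous_vecMean (d := d)
  have h2 := continuous_vecVar (d := d)
  have h3 := (Real.sqrt_pos.2 hz).ne'
  exact (continuousAt_const.mul (ContinuousAt.div (by fun_prop)
    (h2.continuousAt.add continuousAt_const).sqrt h3)).add
    continuousAt_const

/-! ### Attention -/

/-- Softmax depends only on score differences: divide numerator and denominator by the exponential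
of the winning score. -/
theorem tendsto_softmax {α ι : Type*} [Fintype ι] [DecidableEq ι] {l : Filter α} {s : α → ι → ℝ}
    {j₀ : ι} (h : ∀ j, j ≠ j₀ → Tendsto (fun a => s a j - s a j₀) l atBot) (j : ι) :
    Tendsto (fun a => Real.exp (s a j) / ∑ k, Real.exp (s a k)) l
      (𝓝 (if j = j₀ then 1 else 0)) := by
  have key : ∀ k, Tendsto (fun a => Real.exp (s a k - s a j₀)) l
      (𝓝 (if k = j₀ then 1 else 0)) := by
    intro k
    by_cases hk : k = j₀
    · simpa [hk] using tendsto_const_nhds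
    · simpa only [hk, if_false, Function.comp_def] using Real.tendsto_exp_atBot.comp (h k hk)
  have := (key j).div (tendsto_finsetSum Finset.univ fun k _ => key k) (by simp)
  simp only [Finset.sum_ite_eq', Finset.mem_univ, if_true, div_one] at this
  refine this.congr fun a => ?_
  simp only [Pi.div_apply, Real.exp_sub, ← Finset.sum_div]
  field_simp

theorem HeadParams.continuous_apply {d dh W : ℕ} (p : HeadParams d dh) (i : Fin W) :
    Continuous fun h : Fin W → Fin d → ℝ => p.apply h i := by
  have hs : ∀ j, Continuous fun h : Fin W → Fin d → ℝ => p.score h i j := by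
    intro j
    unfold HeadParams.score
    fun_prop
  have hw : ∀ j, Continuous fun h : Fin W → Fin d → ℝ => p.weight h i j := fun j =>
    Continuous.div (hs j).rexp (continuous_finsetSum _ fun k _ => (hs k).rexp) fun h =>
      (Finset.sum_pos (fun k _ => Real.exp_pos _) ⟨i, Finset.mem_univ i⟩).ne'
  unfold HeadParams.apply
  fun_prop

theorem AttentionParams.continuous_apply {d H dh W : ℕ} (p : AttentionParams d H dh) (i : Fin W) :
    Continuous fun h : Fin W → Fin d → ℝ => p.apply h i := by
  have := fun a => (p.head a).continuous_apply i
  unfold AttentionParams.apply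
  fun_prop

/-- Head by which position `i` looks, with sharpness `β`, for the position `j` such that
`g j = i`, and reads its bit. -/
def lookupHead {W : ℕ} (g : Fin W → Fin W) (β : ℝ) : HeadParams (2 * W + 6) (W + 3) where
  Wq := Fin.addCases (fun k => Pi.single (coord (Sum.inl (g k))) β) 0
  bq := 0
  Wk := Fin.addCases (fun k => Pi.single (coord (Sum.inl k)) 1) 0
  bk := 0
  Wv := fun _ => Pi.single (coord (Sum.inr 0)) 1
  bv := 0

/-- Only the `j`-th key entry is nonzero, and the query has `β` there exactly when `g j = i`; the
last three entries are padding. -/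
theorem lookupHead_score {W : ℕ} (g : Fin W → Fin W) (β : ℝ) (u : Fin W → Bool) (i j : Fin W) :
    (lookupHead g β).score (rowCode u) i j = (if g j = i then β else 0) / Real.sqrt (W + 3 : ℕ) := by
  unfold HeadParams.score
  congr 1
  rw [dotProduct, Fin.sum_univ_add]
  simp [lookupHead, Matrix.mulVec, rowCode, token_pos]

theorem lookupHead_tendsto {W : ℕ} {g : Fin W → Fin W} {i j₀ : Fin W} (hg : ∀ j, g j = i ↔ j = j₀)
    (u : Fin W → Bool) (a : Fin (W + 3)) :
    Tendsto (fun β => (lookupHead g β).apply (rowCode u) i a) atTop (𝓝 (boolSign (u j₀))) := by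
  have hpos : 0 < Real.sqrt (W + 3 : ℕ) := Real.sqrt_pos.2 (by positivity)
  have hw : ∀ j, Tendsto (fun β => (lookupHead g β).weight (rowCode u) i j) atTop
      (𝓝 (if j = j₀ then 1 else 0)) := by
    refine tendsto_softmax fun j hj => ?_
    simp only [lookupHead_score, hg, hj, if_true, if_false, zero_div, zero_sub]
    exact tendsto_neg_atTop_atBot.comp (tendsto_id.atTop_div_const hpos)
  have := tendsto_finsetSum Finset.univ fun j _ => (hw j).mul_const (boolSign (u j))
  simp only [ite_mul, one_mul, zero_mul, Finset.sum_ite_eq', Finset.mem_univ, if_true] at this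
  refine this.congr fun β => ?_
  simp [HeadParams.apply, lookupHead, Matrix.mulVec, single_dotProduct, rowCode, token_bit]

/-- Attention that copies the bits of the two neighbours. -/
def neighbourAttention (W : ℕ) [NeZero W] (β : ℝ) : AttentionParams (2 * W + 6) 2 (W + 3) where
  head := ![lookupHead (fun k => k + 1) β, lookupHead (fun k => k - 1) β]
  Wo := fun k a => if a.2 = 0 then lift (Pi.single (Sum.inr a.1.succ) 1) k else 0
  bo := 0

theorem neighbourAttention_apply {W : ℕ} [NeZero W] (β : ℝ) (h : Fin W → Fin (2 * W + 6) → ℝ)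
    (i : Fin W) :
    (neighbourAttention W β).apply h i =
      lift (Sum.elim 0 ![0, (lookupHead (fun k => k + 1) β).apply h i 0,
        (lookupHead (fun k => k - 1) β).apply h i 0]) := by
  have e : ∀ x y : ℝ, (Sum.elim 0 ![0, x, y] : Feature W → ℝ) =
      x • Pi.single (Sum.inr 1) 1 + y • Pi.single (Sum.inr 2) 1 := by
    intro x y
    ext (k | a)
    · simp
    · fin_cases a <;> simp
  rw [e, map_add, map_smul, map_smul]
  ext k
  simp [AttentionParams.apply, neighbourAttention, Matrix.mulVec, dotProduct,
    Fintype.sum_prod_type, Fin.sum_univ_two, mul_comm]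

/-! ### Feed-forward network -/

theorem FFNParams.continuous_apply {d F : ℕ} (p : FFNParams d F) : Continuous p.apply := by
  unfold FFNParams.apply
  fun_prop

/-- Eight of the hidden units stand for the patterns of a neighbourhood. -/
def unitEquiv : (Bool × Bool × Bool) ⊕ Fin 6 ≃ Fin 14 :=
  Fintype.equivOfCardEq (by simp)

/-- Feed-forward network that overwrites the bit according to `f` and clears the neighbour bits. -/
def ruleFFN (W : ℕ) (f : LocalRule) : FFNParams (2 * W + 6) 14 where
  W₁ := fun k => Sum.elim
    (fun p => Pi.single (coord (Sum.inr 1)) (boolSign p.1) +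
      Pi.single (coord (Sum.inr 0)) (boolSign p.2.1) +
      Pi.single (coord (Sum.inr 2)) (boolSign p.2.2)) 0 (unitEquiv.symm k)
  b₁ := fun _ => -2
  W₂ := fun c k => Sum.elim
    (fun p => lift (Sum.elim 0 ![boolSign (f p) - boolSign p.2.1, -boolSign p.1,
      -boolSign p.2.2]) c) 0 (unitEquiv.symm k)
  b₂ := 0

/-- Two sign triples have inner product 3 if equal and at most 1 otherwise, so the threshold 2
separates them with margin exactly 1. -/
theorem max_pattern (p q : Bool × Bool × Bool) :
    max (boolSign p.1 * boolSign q.1 + boolSign p.2.1 * boolSign q.2.1 +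
      boolSign p.2.2 * boolSign q.2.2 + -2) 0 = if p = q then 1 else 0 := by
  obtain ⟨a, b, c⟩ := p
  obtain ⟨a', b', c'⟩ := q
  cases a <;> cases b <;> cases c <;> cases a' <;> cases b' <;> cases c' <;>
    norm_num [boolSign]

theorem ruleFFN_preactivation {W : ℕ} (f : LocalRule) (p : Bool × Bool × Bool) (i : Fin W)
    (s l r : ℝ) :
    ((ruleFFN W f).W₁ *ᵥ token i s l r) (unitEquiv (Sum.inl p)) =
      boolSign p.1 * l + boolSign p.2.1 * s + boolSign p.2.2 * r := by
  have h : (ruleFFN W f).W₁ (unitEquiv (Sum.inl p)) =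
      Pi.single (coord (Sum.inr 1)) (boolSign p.1) +
      Pi.single (coord (Sum.inr 0)) (boolSign p.2.1) +
      Pi.single (coord (Sum.inr 2)) (boolSign p.2.2) := by
    simp only [ruleFFN, Equiv.symm_apply_apply, Sum.elim_inl]
  rw [Matrix.mulVec, h, add_dotProduct, add_dotProduct]
  simp [token_bit]

/-- Exactly one pattern unit fires, with value 1. It writes a difference, because the residual
connection adds the old entries back. -/
theorem ruleFFN_apply {W : ℕ} (f : LocalRule) (i : Fin W) (l s r : Bool) :
    (ruleFFN W f).apply (token i (boolSign s) (boolSign l) (boolSign r)) =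
      lift (Sum.elim 0 ![boolSign (f (l, s, r)) - boolSign s, -boolSign l, -boolSign r]) := by
  ext c
  have h := max_pattern (q := (l, s, r))
  simp only at h
  simp only [FFNParams.apply, Pi.add_apply]
  rw [Matrix.mulVec, dotProduct, ← unitEquiv.sum_comp, Fintype.sum_sum_type]
  simp only [ruleFFN_preactivation]
  simp [ruleFFN, h]

/-! ### Blocks -/

namespace BlockParams

variable {d H dh F W : ℕ}

theorem continuous_preNorm₁ (p : BlockParams d H dh F) (i : Fin W) :
    Continuous fun h : Fin W → Fin d → ℝ => p.preNorm₁ h i := by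
  have := p.attn.continuous_apply i
  unfold preNorm₁
  fun_prop

theorem continuousAt_preNorm₂ (p : BlockParams d H dh F) {ε : ℝ} {h : Fin W → Fin d → ℝ}
    {i : Fin W} (h₁ : 0 < vecVar (p.preNorm₁ h i) + ε) :
    ContinuousAt (fun h => p.preNorm₂ ε h i) h := by
  have hm : ContinuousAt (fun h => p.mid ε h i) h :=
    (p.ln₁.continuousAt_apply h₁).comp (f := fun h => p.preNorm₁ h i)
      (p.continuous_preNorm₁ i).continuousAt
  exact hm.add (p.ffn.continuous_apply.continuousAt.comp hm)

theorem continuousAt_apply (p : BlockParams d H dh F) {ε : ℝ} {h : Fin W → Fin d → ℝ}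
    {i : Fin W} (h₁ : 0 < vecVar (p.preNorm₁ h i) + ε) (h₂ : 0 < vecVar (p.preNorm₂ ε h i) + ε) :
    ContinuousAt (fun h => p.apply ε h i) h :=
  (p.ln₂.continuousAt_apply h₂).comp (f := fun h => p.preNorm₂ ε h i) (p.continuousAt_preNorm₂ h₁)

/-- Both LayerNorms of the block are evaluated away from their singularity. -/
def Regular (p : BlockParams d H dh F) (ε : ℝ) (h : Fin W → Fin d → ℝ) : Prop :=
  ∀ i, 0 < vecVar (p.preNorm₁ h i) + ε ∧ 0 < vecVar (p.preNorm₂ ε h i) + ε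

theorem Regular.eventually {p : BlockParams d H dh F} {ε : ℝ} {h : Fin W → Fin d → ℝ}
    (hp : p.Regular ε h) : ∀ᶠ h' in 𝓝 h, p.Regular ε h' := by
  refine eventually_all.2 fun i => ?_
  have c₁ := (continuous_vecVar.continuousAt.comp (p.continuous_preNorm₁ i).continuousAt).add_const
    (x := h) ε
  have c₂ := (continuous_vecVar.continuousAt.comp (p.continuousAt_preNorm₂ (hp i).1)).add_const ε
  exact (c₁.eventually (lt_mem_nhds (hp i).1)).and (c₂.eventually (lt_mem_nhds (hp i).2))

theorem Regular.continuousAt {p : BlockParams d H dh F} {ε : ℝ} {h : Fin W → Fin d → ℝ}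
    (hp : p.Regular ε h) : ContinuousAt (p.apply ε) h :=
  continuousAt_pi.2 fun i => p.continuousAt_apply (hp i).1 (hp i).2

end BlockParams

/-- Block that approximately performs one update by `f`, the better the larger `β` is. -/
def ruleBlock (W : ℕ) [NeZero W] (ε : ℝ) (f : LocalRule) (β : ℝ) :
    BlockParams (2 * W + 6) 2 (W + 3) 14 where
  attn := neighbourAttention W β
  ln₁ := identityNorm _ ε (8 / (2 * W + 6 : ℕ))
  ffn := ruleFFN W f
  ln₂ := identityNorm _ ε (4 / (2 * W + 6 : ℕ))

theorem identityNorm_token {W : ℕ} {ε v : ℝ} (hε : 0 ≤ ε) {i : Fin W} {s l r : ℝ}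
    (hv : 2 * (1 + s ^ 2 + l ^ 2 + r ^ 2) = v) :
    0 < vecVar (token i s l r) + ε ∧
    (identityNorm _ ε (v / (2 * W + 6 : ℕ))).apply ε (token i s l r) = token i s l r := by
  have h : 0 < v / (2 * W + 6 : ℕ) + ε := by
    have : 0 < v := by rw [← hv]; positivity
    positivity
  rw [vecVar_token, hv]
  exact ⟨h, identityNorm_apply (vecMean_lift _) (by rw [vecVar_token, hv]) h⟩

/-! ### The limit of infinite sharpness -/

section Limit

variable {W : ℕ} [NeZero W] {ε : ℝ} (f : LocalRule) (u : Fin W → Bool) (i : Fin W)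

theorem ruleBlock_preNorm₁_tendsto :
    Tendsto (fun β => (ruleBlock W ε f β).preNorm₁ (rowCode u) i) atTop
      (𝓝 (token i (boolSign (u i)) (boolSign (u (i - 1))) (boolSign (u (i + 1))))) := by
  -- Shifts of the ring are bijective, so each target is unique. The two may coincide for small `W`,
  -- harmlessly, as the heads write to separate features.
  have hl := lookupHead_tendsto (g := fun k => k + 1) (i := i) (j₀ := i - 1)
    (fun j => eq_sub_iff_add_eq.symm) u 0
  have hr := lookupHead_tendsto (g := fun k => k - 1) (i := i) (j₀ := i + 1)
    (fun j => sub_eq_iff_eq_add) u 0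
  have hc : Continuous fun y : ℝ × ℝ => token i (boolSign (u i)) y.1 y.2 := by
    refine (LinearMap.continuous_of_finiteDimensional lift).comp (continuous_pi ?_)
    rintro (k | a)
    · exact continuous_const
    · fin_cases a
      · exact continuous_const
      · exact continuous_fst
      · exact continuous_snd
  refine ((hc.tendsto (_, _)).comp (hl.prodMk_nhds hr)).congr fun β => ?_
  simp only [Function.comp, BlockParams.preNorm₁, ruleBlock, neighbourAttention_apply]
  rw [rowCode, token_add]
  simp only [add_zero, zero_add]

theorem ruleBlock_preNorm₂_tendsto (hε : 0 ≤ ε) :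
    Tendsto (fun β => (ruleBlock W ε f β).preNorm₂ ε (rowCode u) i) atTop
      (𝓝 (rowCode (caStep f u) i)) := by
  -- The position and three signs contribute 1 each, and every feature counts twice.
  obtain ⟨hpos, hid⟩ := identityNorm_token hε (i := i) (v := 8) (s := boolSign (u i))
    (l := boolSign (u (i - 1))) (r := boolSign (u (i + 1))) (by simp only [boolSign_sq]; norm_num)
  have h₁ := (LayerNormParams.continuousAt_apply (identityNorm _ ε (8 / (2 * W + 6 : ℕ)))
    hpos).tendsto.comp (ruleBlock_preNorm₁_tendsto (ε := ε) f u i)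
  rw [hid] at h₁
  have h₂ := h₁.add (((ruleFFN W f).continuous_apply.tendsto _).comp h₁)
  rw [ruleFFN_apply, token_add] at h₂
  simp only [add_sub_cancel, add_neg_cancel] at h₂
  exact h₂

theorem ruleBlock_apply_tendsto (hε : 0 ≤ ε) :
    Tendsto (fun β => (ruleBlock W ε f β).apply ε (rowCode u)) atTop
      (𝓝 (rowCode (caStep f u))) := by
  refine tendsto_pi_nhds.2 fun i => ?_
  obtain ⟨hpos, hid⟩ := identityNorm_token hε (i := i) (v := 4) (s := boolSign (caStep f u i))
    (l := 0) (r := 0) (by simp only [boolSign_sq]; norm_num)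
  have h := (LayerNormParams.continuousAt_apply (identityNorm _ ε (4 / (2 * W + 6 : ℕ)))
    hpos).tendsto.comp (ruleBlock_preNorm₂_tendsto f u i hε)
  rw [hid] at h
  exact h

theorem ruleBlock_eventually_regular (hε : 0 ≤ ε) :
    ∀ᶠ β in atTop, (ruleBlock W ε f β).Regular ε (rowCode u) := by
  refine eventually_all.2 fun i => ?_
  have h₁ := ((continuous_vecVar.tendsto _).comp
    (ruleBlock_preNorm₁_tendsto (ε := ε) f u i)).add_const ε
  have h₂ := ((continuous_vecVar.tendsto _).comp
    (ruleBlock_preNorm₂_tendsto f u i hε)).add_const ε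
  refine (h₁.eventually (lt_mem_nhds ?_)).and (h₂.eventually (lt_mem_nhds ?_))
  · exact (identityNorm_token hε rfl).1
  · exact (identityNorm_token hε rfl).1

end Limit

theorem exists_block {W : ℕ} [NeZero W] {ε : ℝ} (hε : 0 ≤ ε) (f : LocalRule)
    {N : (Fin W → Bool) → Set (Fin W → Fin (2 * W + 6) → ℝ)} (hN : ∀ u, N u ∈ 𝓝 (rowCode u)) :
    ∃ p : BlockParams (2 * W + 6) 2 (W + 3) 14, ∀ u, ∀ᶠ h in 𝓝 (rowCode u),
      p.Regular ε h ∧ p.apply ε h ∈ N (caStep f u) := by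
  -- One `β` serves all rows, as they are finite in number. The image of each code is put where `N`
  -- is still a neighbourhood, so that continuity extends the conclusion to nearby inputs.
  obtain ⟨β, hβ⟩ := (eventually_all.2 fun u => (ruleBlock_eventually_regular f u hε).and
    ((ruleBlock_apply_tendsto f u hε).eventually
      (eventually_mem_nhds_iff.2 (hN (caStep f u))))).exists
  exact ⟨ruleBlock W ε f β, fun u => (hβ u).1.eventually.and
    ((hβ u).1.continuousAt.tendsto.eventually (hβ u).2)⟩

/-! ### Stacks of blocks -/

theorem Fin.induction_castSucc_eq {α : Type*} {T : ℕ} (a : α) (s : Fin (T + 1) → α → α)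
    (t : Fin (T + 1)) :
    (Fin.induction (motive := fun _ => α) a s t.castSucc : α) =
      Fin.induction (motive := fun _ => α) a (fun k => s k.castSucc) t := by
  induction t using Fin.induction with
  | zero => rfl
  | succ k ih =>
    rw [← Fin.succ_castSucc, Fin.induction_succ, Fin.induction_succ, ih]

/-- The token vectors after each block of a stack. -/
def stackRun {d H dh F W T : ℕ} (ε : ℝ) (p : Fin T → BlockParams d H dh F)
    (h : Fin W → Fin d → ℝ) : Fin (T + 1) → Fin W → Fin d → ℝ :=
  Fin.induction (motive := fun _ => Fin W → Fin d → ℝ) h (fun t h => (p t).apply ε h)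

theorem exists_stack {W : ℕ} [NeZero W] {ε : ℝ} (hε : 0 ≤ ε) {T : ℕ} (f : Fin T → LocalRule)
    {N : (Fin W → Bool) → Set (Fin W → Fin (2 * W + 6) → ℝ)} (hN : ∀ u, N u ∈ 𝓝 (rowCode u)) :
    ∃ p : Fin T → BlockParams (2 * W + 6) 2 (W + 3) 14, ∀ u, ∀ᶠ h in 𝓝 (rowCode u),
      (∀ t, (p t).Regular ε (stackRun ε p h t.castSucc)) ∧
      stackRun ε p h (Fin.last T) ∈ N (caState f u (Fin.last T)) := by
  induction T generalizing N with
  | zero => exact ⟨Fin.elim0, fun u =>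
      mem_of_superset (hN u) fun h hh => ⟨fun t => t.elim0, hh⟩⟩
  | succ T ih =>
    obtain ⟨q, hq⟩ := exists_block hε (f (Fin.last T)) hN
    -- The inputs on which the last block succeeds form the target neighbourhoods for the earlier
    -- blocks.
    obtain ⟨p, hp⟩ := ih (fun t => f t.castSucc) hq
    refine ⟨Fin.snoc p q, fun u => (hp u).mono fun h hh => ?_⟩
    have hrun : ∀ t : Fin (T + 1), stackRun ε (Fin.snoc p q : Fin (T + 1) → _) h t.castSucc =
        stackRun ε p h t := by
      intro t
      rw [stackRun, Fin.induction_castSucc_eq]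
      simp [stackRun]
    have hca : caState f u (Fin.last T).castSucc =
        caState (fun t => f t.castSucc) u (Fin.last T) := Fin.induction_castSucc_eq _ _ _
    refine ⟨fun t => ?_, ?_⟩
    · induction t using Fin.lastCases with
      | last =>
        rw [hrun, Fin.snoc_last]
        exact hh.2.1
      | cast t =>
        rw [hrun, Fin.snoc_castSucc]
        exact hh.1 t
    · have h1 : stackRun ε (Fin.snoc p q : Fin (T + 1) → _) h (Fin.last (T + 1)) =
          q.apply ε (stackRun ε p h (Fin.last T)) := by
        rw [← hrun, ← Fin.succ_last, stackRun, Fin.induction_succ, Fin.snoc_last]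
      have h2 : caState f u (Fin.last (T + 1)) = caStep (f (Fin.last T))
          (caState (fun t => f t.castSucc) u (Fin.last T)) := by
        rw [← hca, ← Fin.succ_last, caState, Fin.induction_succ]
      rw [h1, h2]
      exact hh.2.2

/-- The encoder that feeds the code of a row into a stack of blocks and reads off the bit. -/
def codeEncoder {W T : ℕ} (p : Fin T → BlockParams (2 * W + 6) 2 (W + 3) 14) :
    Encoder W (2 * W + 6) 2 (W + 3) 14 T where
  embW := lift (Sum.elim 0 ![2, 0, 0])
  embB := lift (Sum.elim 0 ![-1, 0, 0])
  pos := fun i => token i 0 0 0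
  block := p
  outW := Pi.single (coord (Sum.inr 0)) 1
  outB := 0

/-- The embedding turns a bit `x` into the sign `2x - 1`. -/
theorem codeEncoder_input {W T : ℕ} (p : Fin T → BlockParams (2 * W + 6) 2 (W + 3) 14)
    (x : Fin W → Bool) : (codeEncoder p).input x = rowCode x := by
  ext1 j
  simp only [Encoder.input, codeEncoder, rowCode]
  rw [add_comm (_ + _) (token _ _ _ _), add_comm (_ • _), ← add_assoc, token_add]
  cases hx : x j
  · simp [boolSign]
  · simp only [if_true, one_smul, token_add]
    norm_num [boolSign]

theorem setOf_sign_mem_nhds {W : ℕ} (u : Fin W → Bool) :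
    {h : Fin W → Fin (2 * W + 6) → ℝ | ∀ i, 0 < h i (coord (Sum.inr 0)) ↔ u i = true} ∈
      𝓝 (rowCode u) := by
  refine eventually_all.2 fun i => ?_
  have hc : Tendsto (fun h : Fin W → Fin (2 * W + 6) → ℝ => h i (coord (Sum.inr 0)))
      (𝓝 (rowCode u)) (𝓝 (boolSign (u i))) := by
    have : Continuous fun h : Fin W → Fin (2 * W + 6) → ℝ => h i (coord (Sum.inr 0)) := by
      fun_prop
    simpa [rowCode, token_bit] using this.tendsto (rowCode u)
  cases hu : u i
  · rw [hu] at hc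
    filter_upwards [hc.eventually (gt_mem_nhds (show boolSign false < 0 by simp [boolSign]))]
      with h hh
    simpa using hh.le
  · rw [hu] at hc
    filter_upwards [hc.eventually (lt_mem_nhds (show 0 < boolSign true by simp [boolSign]))]
      with h hh
    simpa using hh

end

theorem mainTheorem6 (W : ℕ) [NeZero W] (T : ℕ) (f : Fin T → LocalRule) (ε : ℝ) (hε : 0 ≤ ε) :
    ∃ m : Encoder W (2 * W + 6) 2 (W + 3) 14 T,
      ∀ x : Fin W → Bool,
        m.NormsDefined ε x ∧
        ∀ i : Fin W, 0 < m.logit ε x i ↔ caState f x (Fin.last T) i = true := by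
  obtain ⟨p, hp⟩ := exists_stack (W := W) hε f setOf_sign_mem_nhds
  refine ⟨codeEncoder p, fun x => ?_⟩
  obtain ⟨hreg, hsign⟩ := (hp x).self_of_nhds
  have hrun : (codeEncoder p).hidden ε x = stackRun ε p (rowCode x) := by
    rw [Encoder.hidden, codeEncoder_input]
    rfl
  refine ⟨fun t i => ?_, fun i => ?_⟩
  · rw [hrun]
    exact hreg t i
  · rw [Encoder.logit, hrun]
    simpa [codeEncoder, single_dotProduct] using hsign i
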